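/- Let $G$ be a totally disconnected locally compact group that is compactly generated and Gromov hyperbolic, i.e. for some compact generating set the associated word metric on $G$ is Gromov hyperbolic. Let $\Gamma < G$ be a finitely generated lattice, i.e. a finitely generated discrete subgroup such that $G/\Gamma$ carries a nonzero finite $G$-invariant regular Borel measure. Let $S$ be any compact generating set of $G$ and $T$ any finite generating set of $\Gamma$, with word metrics $d_S$ on $G$ and $d_T$ on $\Gamma$. Then the following assertions are equivalent. 1. $\Gamma$ is a uniform lattice, i.e. $G/\Gamma$ is compact. 2. $\Gamma$ is undistorted in $G$, i.e. the inclusion $(\Gamma, d_T) \to (G, d_S)$ is a quasi-isometric embedding: there are constants $L \geq 1$ and $C \geq 0$ with $L^{-1} d_T(\gamma,\gamma') - C \leq d_S(\gamma,\gamma') \leq L\, d_T(\gamma,\gamma') + C$ for all $\gamma,\gamma' \in \Gamma$. 3. $\Gamma$ is a Gromov hyperbolic group, i.e. $(\Gamma, d_T)$ is Gromov hyperbolic. Here a metric space $(X,d)$ is called Gromov hyperbolic if there is $\delta$ such that $(x|z)_w \geq \min\{(x|y)_w, (y|z)_w\} - \delta$ for all $w,x,y,z \in X$, where $(x|y)_w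 = \frac12\bigl(d(x,w)+d(y,w)-d(x,y)\bigr)$. -/

import Mathlib

open MeasureTheory

noncomputable section

/-- The word length of `g` with respect to `S`: the least length of a word in the letters
`S ∪ S⁻¹` that represents `g`. (Only used when `S` generates the group.) -/
def wordLength {G : Type*} [Group G] (S : Set G) (g : G) : ℕ :=
  sInf {n : ℕ | ∃ l : List G, l.length = n ∧ (∀ x ∈ l, x ∈ S ∨ x⁻¹ ∈ S) ∧ l.prod = g}

/-- The (left-invariant) word metric with respect to `S`. -/
def wordDist {G : Type*} [Group G] (S : Set G) (g h : G) : ℝ :=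
  (wordLength S (g⁻¹ * h) : ℝ)

/-- The Gromov product `(x | y)_w` for a distance function `d`. -/
def gromovProduct {X : Type*} (d : X → X → ℝ) (w x y : X) : ℝ :=
  (d x w + d y w - d x y) / 2

/-- Gromov hyperbolicity of a distance function. -/
def IsGromovHyperbolic {X : Type*} (d : X → X → ℝ) : Prop :=
  ∃ δ : ℝ, ∀ w x y z : X,
    min (gromovProduct d w x y) (gromovProduct d w y z) - δ ≤ gromovProduct d w x z

/-- `S` is a compact generating set of the topological group `G`. -/
def IsCompactGeneratingSet {G : Type*} [Group G] [TopologicalSpace G] (S : Set G) : Prop :=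
  IsCompact S ∧ Subgroup.closure S = ⊤

/-- `G` is compactly generated, and Gromov hyperbolic for the word metric of a
compact generating set. -/
def IsGromovHyperbolicGroup (G : Type*) [Group G] [TopologicalSpace G] : Prop :=
  ∃ S : Set G, IsCompactGeneratingSet S ∧ IsGromovHyperbolic (wordDist S)

/-- `f` is a quasi-isometric embedding for the distance functions `dX` and `dY`. -/
def IsQuasiIsometricEmbedding {X Y : Type*} (dX : X → X → ℝ) (dY : Y → Y → ℝ)
    (f : X → Y) : Prop :=
  ∃ L C : ℝ, 1 ≤ L ∧ 0 ≤ C ∧ ∀ x x' : X,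
    L⁻¹ * dX x x' - C ≤ dY (f x) (f x') ∧ dY (f x) (f x') ≤ L * dX x x' + C

/-- A lattice: a discrete subgroup `Γ` such that `G ⧸ Γ` carries a nonzero finite
`G`-invariant regular Borel measure. -/
def IsLatticeSubgroup {G : Type*} [Group G] [TopologicalSpace G] (Γ : Subgroup G) : Prop :=
  DiscreteTopology Γ ∧
    letI : MeasurableSpace (G ⧸ Γ) := borel (G ⧸ Γ)
    ∃ μ : Measure (G ⧸ Γ), μ ≠ 0 ∧ IsFiniteMeasure μ ∧ μ.Regular ∧
      SMulInvariantMeasure G (G ⧸ Γ) μ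

/-- `Γ` is cocompact in `G`; a lattice with this property is uniform. -/
def IsUniformSubgroup {G : Type*} [Group G] [TopologicalSpace G] (Γ : Subgroup G) : Prop :=
  CompactSpace (G ⧸ Γ)

/-- `Γ`, with the word metric of `T`, is undistorted in `G`, with the word metric of `S`. -/
def IsUndistorted {G : Type*} [Group G] (S : Set G) (Γ : Subgroup G) (T : Set Γ) : Prop :=
  IsQuasiIsometricEmbedding (wordDist T) (wordDist S) (fun γ : Γ => (γ : G))

end

/-! ### Gromov products and discrete geodesics -/

open MeasureTheory
open scoped Pointwise NNReal ENNReal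

/-! The implications are proved in a cycle. If `Γ` is uniform, then `G = KΓ` with `K` compact, and
rounding the suffixes of a word in `S` to `Γ` gives the Milnor–Švarc estimate
(`IsUniformSubgroup.isUndistorted`). If `Γ` is undistorted, its geodesics become quasi-geodesics of
the hyperbolic space `G`; these stay close to geodesics
(`GromovInequality.exists_gromovProduct_quasiGeodesic_le`), so thinness of triangles pulls back to
`Γ` (`IsQuasiIsometricEmbedding.isGromovHyperbolic`).

The way back from hyperbolicity to cocompactness goes through finite subgroups. A finite subgroup of
a hyperbolic group almost fixes its quasi-centre, so a conjugate of it lies in a fixed ball and its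
order is bounded (`exists_card_le_of_isGromovHyperbolic`). Let a compact open subgroup `W` act on `G
⧸ Γ`. The stabilizer of `gΓ` is conjugate to a finite subgroup of `Γ`, so its order is bounded, and
the orbit has measure at least a constant times `Δ(g⁻¹)`, with `Δ` the modular character
(`modularCharacter_mul_measure_le`). Finite total mass bounds `Δ`, which forces `Δ = 1`. Then all
orbits have mass bounded below, so there are finitely many of them, and each is compact
(`IsLatticeSubgroup.isUniformSubgroup_of_card_le`). -/

/-- A distance function for which any two points are joined by a path of unit steps realizing
the distance, such as a word metric. -/
structure IsDiscreteGeodesic {X : Type*} (d : X → X → ℝ) : Prop where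
  self : ∀ x, d x x = 0
  symm : ∀ x y, d x y = d y x
  triangle : ∀ x y z, d x z ≤ d x y + d y z
  exists_path : ∀ x y, ∃ (n : ℕ) (p : ℕ → X), p 0 = x ∧ p n = y ∧
    ∀ i j, i ≤ j → j ≤ n → d (p i) (p j) = (j : ℝ) - i

lemma IsDiscreteGeodesic.nonneg {X : Type*} {d : X → X → ℝ} (hd : IsDiscreteGeodesic d)
    (x y : X) : 0 ≤ d x y := by
  have h1 := hd.triangle x y x
  have h2 := hd.symm x y
  have h3 := hd.self x
  linarith

/-- The hyperbolicity inequality with the constant `δ`. -/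
def GromovInequality {X : Type*} (d : X → X → ℝ) (δ : ℝ) : Prop :=
  ∀ w x y z : X,
    min (gromovProduct d w x y) (gromovProduct d w y z) - δ ≤ gromovProduct d w x z

lemma IsGromovHyperbolic.exists_nonneg {X : Type*} {d : X → X → ℝ} (h : IsGromovHyperbolic d) :
    ∃ δ, 0 ≤ δ ∧ GromovInequality d δ := by
  obtain ⟨δ, hδ⟩ := h
  refine ⟨max δ 0, le_max_right _ _, fun w x y z => ?_⟩
  have := hδ w x y z
  have := le_max_left δ 0
  linarith

/-- Clearing the common terms of the Gromov products leaves a comparison of the three ways to pair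
four points, in which no base point is distinguished. -/
lemma GromovInequality.four_point {X : Type*} {d : X → X → ℝ} {δ : ℝ}
    (H : GromovInequality d δ) (x y z w : X) :
    d x z + d y w ≤ max (d x y + d z w) (d y z + d x w) + 2 * δ := by
  have h := H w x y z
  unfold gromovProduct at h
  rcases le_total (d x y + d z w) (d y z + d x w) with h1 | h1
  · rw [max_eq_right h1]
    rcases min_le_iff.1 (by linarith : min ((d x w + d y w - d x y) / 2)
      ((d y w + d z w - d y z) / 2) ≤ (d x w + d z w - d x z) / 2 + δ) with h2 | h2 <;> linarith
  · rw [max_eq_left h1]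
    rcases min_le_iff.1 (by linarith : min ((d x w + d y w - d x y) / 2)
      ((d y w + d z w - d y z) / 2) ≤ (d x w + d z w - d x z) / 2 + δ) with h2 | h2 <;> linarith

lemma gromovProduct_comm {X : Type*} {d : X → X → ℝ} (hd : IsDiscreteGeodesic d) (w x y : X) :
    gromovProduct d w x y = gromovProduct d w y x := by
  unfold gromovProduct
  rw [hd.symm x y]
  ring

/-- Along a chain of at most `2 ^ k` steps the Gromov product drops by at most `k * δ`. -/
lemma GromovInequality.chain {X : Type*} {d : X → X → ℝ} {δ : ℝ} (hδ : 0 ≤ δ)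
    (H : GromovInequality d δ) (w : X) (p : ℕ → X) (m : ℝ) (k : ℕ) :
    ∀ a b : ℕ, a < b → b ≤ a + 2 ^ k →
      (∀ i, a ≤ i → i < b → m ≤ gromovProduct d w (p i) (p (i + 1))) →
      m - k * δ ≤ gromovProduct d w (p a) (p b) := by
  induction k with
  | zero =>
    intro a b hab hb h
    obtain rfl : b = a + 1 := by simp at hb; omega
    simpa using h a le_rfl hab
  | succ k ih =>
    intro a b hab hb h
    push_cast
    by_cases hb' : b ≤ a + 2 ^ k
    · have := ih a b hab hb' h
      linarith
    · have hpos : 0 < 2 ^ k := by positivity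
      rw [pow_succ] at hb
      have h1 := ih a (a + 2 ^ k) (by omega) le_rfl (fun i hi hi' => h i hi (by omega))
      have h2 := ih (a + 2 ^ k) b (by omega) (by omega) (fun i hi hi' => h i (by omega) hi')
      have h3 := H w (p a) (p (a + 2 ^ k)) (p b)
      have h4 := le_min h1 h2
      linarith

/-- A bound of a number by the logarithm of an affine function of it bounds the number. -/
lemma exists_bound_of_le_log (A B K δ : ℝ) (hA : 0 < A) (hδ : 0 ≤ δ) :
    ∃ D₀, ∀ D : ℝ, (∀ k : ℕ, A * D + B ≤ 2 ^ k → D ≤ K + k * δ) → D ≤ D₀ := by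
  -- The numerator is `A * D + B` at `D = K + (k + 1) * δ`; linear growth loses to `2 ^ k`.
  have hlim : Filter.Tendsto (fun k : ℕ => (A * K + B + A * δ + k * (A * δ)) / (2 : ℝ) ^ k)
      Filter.atTop (nhds 0) := by
    have h1 : Filter.Tendsto (fun k : ℕ => (k : ℝ) ^ 1 / (2 : ℝ) ^ k) Filter.atTop (nhds 0) :=
      tendsto_pow_const_div_const_pow_of_one_lt 1 (by norm_num)
    have h0 : Filter.Tendsto (fun k : ℕ => (k : ℝ) ^ 0 / (2 : ℝ) ^ k) Filter.atTop (nhds 0) :=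
      tendsto_pow_const_div_const_pow_of_one_lt 0 (by norm_num)
    have := (h0.const_mul (A * K + B + A * δ)).add (h1.const_mul (A * δ))
    simp only [mul_zero, add_zero] at this
    refine this.congr fun k => ?_
    simp only [pow_zero, pow_one]
    ring
  obtain ⟨k₀, hk₀⟩ := Filter.eventually_atTop.1 (hlim.eventually (gt_mem_nhds one_pos))
  refine ⟨K + k₀ * δ, fun D hD => ?_⟩
  obtain ⟨k₁, hk₁⟩ := pow_unbounded_of_one_lt (A * D + B) (one_lt_two : (1 : ℝ) < 2)
  classical
  have hex : ∃ k : ℕ, A * D + B ≤ 2 ^ k := ⟨k₁, hk₁.le⟩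
  -- For the least exponent `k`, either `k ≤ k₀`, or `k - 1` is in the range where the exponential
  -- wins, against minimality.
  have hk := Nat.find_spec hex
  rcases Nat.lt_or_ge k₀ (Nat.find hex) with h | h
  · obtain ⟨j, hj⟩ : ∃ j, Nat.find hex = j + 1 := ⟨Nat.find hex - 1, by omega⟩
    have h1 := hk₀ j (by omega)
    have h2 := hD _ hk
    rw [div_lt_one (by positivity)] at h1
    have h3 := Nat.find_min hex (m := j) (by omega)
    rw [hj] at h2
    push_cast at h2
    have h4 := mul_le_mul_of_nonneg_left h2 hA.le
    exfalso
    apply h3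
    nlinarith
  · have h2 := hD _ hk
    have : ((Nat.find hex : ℕ) : ℝ) * δ ≤ k₀ * δ :=
      mul_le_mul_of_nonneg_right (by exact_mod_cast h) hδ
    linarith

/-! ### Stability of quasi-geodesics -/

/-- `p` restricted to `{0, …, n}` is an `(L, C)`-quasi-geodesic. -/
def IsQuasiGeodesic {Y : Type*} (d : Y → Y → ℝ) (L C : ℝ) (p : ℕ → Y) (n : ℕ) : Prop :=
  ∀ i j, i ≤ j → j ≤ n →
    L⁻¹ * ((j : ℝ) - i) - C ≤ d (p i) (p j) ∧ d (p i) (p j) ≤ L * ((j : ℝ) - i) + C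

lemma IsQuasiGeodesic.sub_le {Y : Type*} {d : Y → Y → ℝ} {L C : ℝ} {p : ℕ → Y} {n : ℕ}
    (h : IsQuasiGeodesic d L C p n) (hL : 1 ≤ L) {i j : ℕ} (hij : i ≤ j) (hj : j ≤ n) {r : ℝ}
    (hr : d (p i) (p j) ≤ r) : (j : ℝ) - i ≤ L * (r + C) := by
  have h1 := (h i j hij hj).1
  have h2 : L⁻¹ * ((j : ℝ) - i) ≤ r + C := by linarith
  rwa [inv_mul_le_iff₀ (by linarith)] at h2

/-- The points of a geodesic are close to every quasi-geodesic with the same end points. -/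
lemma GromovInequality.exists_geodesic_near_quasiGeodesic {Y : Type*} {d : Y → Y → ℝ} {δ : ℝ}
    (hd : IsDiscreteGeodesic d) (hδ : 0 ≤ δ) (H : GromovInequality d δ) (L C : ℝ) (hL : 1 ≤ L)
    (hC : 0 ≤ C) :
    ∃ D₀, 0 ≤ D₀ ∧ ∀ (p : ℕ → Y) (n : ℕ) (g : ℕ → Y) (M : ℕ), IsQuasiGeodesic d L C p n →
      g 0 = p 0 → g M = p n → (∀ i j, i ≤ j → j ≤ M → d (g i) (g j) = (j : ℝ) - i) →
      ∀ m ≤ M, ∃ i ≤ n, d (g m) (p i) ≤ D₀ := by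
  -- A detour with ends at most `6 * D + 2` apart has at most `L * (6 * D + 2 + C)` steps. One step
  -- of `p` costs `L + C`, and hyperbolicity is used twice outside the chain.
  obtain ⟨D₀, hD₀⟩ := exists_bound_of_le_log (L * 6) (L * (2 + C)) (L + C + 2 * δ) δ
    (by linarith) hδ
  refine ⟨max D₀ 0, le_max_right _ _, fun p n g M hp h0 hn hg => ?_⟩
  have hmin : ∀ m, ∃ i ≤ n, ∀ j ≤ n, d (g m) (p i) ≤ d (g m) (p j) := by
    intro m
    obtain ⟨i, hi, hi'⟩ := Finset.exists_min_image (Finset.range (n + 1))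
      (fun i => d (g m) (p i)) ⟨0, by simp⟩
    exact ⟨i, by simpa [Nat.lt_succ_iff] using hi, fun j hj => hi' j (by simp; omega)⟩
  choose c hc hc' using hmin
  -- `g m` is the geodesic point farthest from the quasi-geodesic, at distance `D`.
  obtain ⟨m, hm, hmax⟩ := Finset.exists_max_image (Finset.range (M + 1))
    (fun m => d (g m) (p (c m))) ⟨0, by simp⟩
  have hmM : m ≤ M := by simpa [Nat.lt_succ_iff] using hm
  have hmax' : ∀ k ≤ M, d (g k) (p (c k)) ≤ d (g m) (p (c m)) :=
    fun k hk => hmax k (by simp; omega)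
  set D := d (g m) (p (c m)) with hD
  suffices hmain : D ≤ D₀ from fun k hk =>
    ⟨c k, hc k, ((hmax' k hk).trans hmain).trans (le_max_left _ _)⟩
  have hDnonneg : 0 ≤ D := hd.nonneg _ _
  have hfar : ∀ j ≤ n, D ≤ d (p j) (g m) := fun j hj => by
    rw [hd.symm]
    exact hc' m j hj
  apply hD₀
  intro k hk
  -- Moving `2 * D` along the geodesic before jumping to `p` keeps the Gromov product of the jump,
  -- seen from `g m`, at least `D`; if the geodesic ends earlier, its end point lies on `p`.
  obtain ⟨r, hr1, hr2⟩ : ∃ r : ℕ, 2 * D ≤ r ∧ (r : ℝ) ≤ 2 * D + 1 :=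
    ⟨⌈2 * D⌉₊, Nat.le_ceil _, (Nat.ceil_lt_add_one (by linarith)).le⟩
  obtain ⟨a, a', ha, har, ha', hda, hpa⟩ : ∃ a a' : ℕ, a ≤ m ∧ (m : ℝ) - a ≤ r ∧ a' ≤ n ∧
      d (g a) (p a') ≤ D ∧ D ≤ gromovProduct d (g m) (g a) (p a') := by
    unfold gromovProduct
    rcases le_total r m with h | h
    · refine ⟨m - r, c (m - r), Nat.sub_le _ _, ?_, hc _, hmax' _ (by omega), ?_⟩
      · rw [Nat.cast_sub h]; linarith
      · have h1 := hg (m - r) m (Nat.sub_le _ _) hmM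
        rw [Nat.cast_sub h] at h1
        have h2 := hmax' (m - r) (by omega)
        have h3 := hfar _ (hc (m - r))
        linarith
    · refine ⟨0, 0, Nat.zero_le _, by simpa using h, Nat.zero_le _, ?_, ?_⟩
      · rw [h0, hd.self]; exact hDnonneg
      · have := hfar 0 (Nat.zero_le _)
        rw [h0, hd.self]
        linarith
  obtain ⟨b, b', hb, hbM, hbr, hb', hdb, hpb⟩ : ∃ b b' : ℕ, m ≤ b ∧ b ≤ M ∧ (b : ℝ) - m ≤ r ∧
      b' ≤ n ∧ d (g b) (p b') ≤ D ∧ D ≤ gromovProduct d (g m) (p b') (g b) := by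
    unfold gromovProduct
    rcases le_total (m + r) M with h | h
    · refine ⟨m + r, c (m + r), by omega, h, by push_cast; linarith, hc _, hmax' _ h, ?_⟩
      have h1 := hg m (m + r) (by omega) h
      push_cast at h1
      rw [hd.symm] at h1
      have h2 := hmax' (m + r) h
      rw [hd.symm] at h2
      have h3 := hfar _ (hc (m + r))
      linarith
    · refine ⟨M, n, hmM, le_rfl, ?_, le_rfl, ?_, ?_⟩
      · have : (M : ℝ) ≤ m + r := by exact_mod_cast h
        linarith
      · rw [hn, hd.self]; exact hDnonneg
      · have := hfar n le_rfl
        rw [hn, hd.self]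
        linarith
  have hstep : ∀ i, i < n → D - (L + C) ≤ gromovProduct d (g m) (p i) (p (i + 1)) := by
    intro i hi
    have h1 := (hp i (i + 1) (by omega) (by omega)).2
    push_cast at h1
    have h2 := hfar i (by omega)
    have h3 := hfar (i + 1) (by omega)
    unfold gromovProduct
    have : L * ((i : ℝ) + 1 - i) = L := by ring
    linarith
  have hab : d (p a') (p b') ≤ 6 * D + 2 := by
    have h1 := hd.triangle (p a') (g a) (p b')
    have h2 := hd.triangle (g a) (g b) (p b')
    have h3 := hg a b (by omega) hbM
    rw [hd.symm (p a') (g a)] at h1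
    linarith
  have hkδ : 0 ≤ (k : ℝ) * δ := by positivity
  have hlong : ∀ i j, i ≤ j → j ≤ n → d (p i) (p j) ≤ 6 * D + 2 →
      D - (L + C) - k * δ ≤ gromovProduct d (g m) (p i) (p j) := by
    intro i j hij hj hdij
    rcases hij.eq_or_lt with rfl | hlt
    · have := hfar i hj
      unfold gromovProduct
      rw [hd.self]
      linarith
    · refine H.chain hδ (g m) p _ k i j hlt ?_ fun l _ hl => hstep l (by omega)
      have := hp.sub_le hL hij hj hdij
      have h1 : (j : ℝ) ≤ ((i + 2 ^ k : ℕ) : ℝ) := by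
        push_cast
        linarith
      exact_mod_cast h1
  have hmid : D - (L + C) - k * δ ≤ gromovProduct d (g m) (p a') (p b') := by
    rcases le_total a' b' with h | h
    · exact hlong _ _ h hb' hab
    · rw [gromovProduct_comm hd]
      exact hlong _ _ h ha' (by rwa [hd.symm])
  -- The point `g m` lies between `g a` and `g b`, while the detour through `p` makes their Gromov
  -- product large when `D` is large.
  have hzero : gromovProduct d (g m) (g a) (g b) = 0 := by
    unfold gromovProduct
    rw [hg a m ha hmM, hd.symm, hg m b hb hbM, hg a b (by omega) hbM]
    ring
  have h1 := H (g m) (g a) (p a') (g b)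
  have h2 := H (g m) (p a') (p b') (g b)
  have h3 : D - (L + C) - k * δ ≤
      min (gromovProduct d (g m) (p a') (p b')) (gromovProduct d (g m) (p b') (g b)) :=
    le_min hmid (by linarith)
  have h4 : D - (L + C) - k * δ - δ ≤
      min (gromovProduct d (g m) (g a) (p a')) (gromovProduct d (g m) (p a') (g b)) :=
    le_min (by linarith) (by linarith)
  linarith

/-- In a discretely geodesic hyperbolic space the points of a quasi-geodesic are close to the
geodesics between its end points, expressed by a Gromov product. -/
lemma GromovInequality.exists_gromovProduct_quasiGeodesic_le {Y : Type*} {d : Y → Y → ℝ} {δ : ℝ}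
    (hd : IsDiscreteGeodesic d) (hδ : 0 ≤ δ) (H : GromovInequality d δ) (L C : ℝ) (hL : 1 ≤ L)
    (hC : 0 ≤ C) :
    ∃ D, ∀ (p : ℕ → Y) (n : ℕ), IsQuasiGeodesic d L C p n →
      ∀ i ≤ n, gromovProduct d (p i) (p 0) (p n) ≤ D := by
  obtain ⟨D₀, hD₀, hnear⟩ := H.exists_geodesic_near_quasiGeodesic hd hδ L C hL hC
  refine ⟨L * (L * (2 * D₀ + 1 + C)) + C + D₀, fun p n hp i hi => ?_⟩
  obtain ⟨M, g, h0, hM, hg⟩ := hd.exists_path (p 0) (p n)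
  have hnear' := hnear p n g M hp h0 hM hg
  classical
  -- At the last `m` where `g m` is near `p` at an index `≤ i`, it is also near `p` at an index `≥
  -- i`. These indices are boundedly far apart, so `p i` is near `g m`.
  let P : ℕ → Prop := fun m => ∃ j ≤ i, d (g m) (p j) ≤ D₀
  have hP0 : P 0 := ⟨0, Nat.zero_le _, by rw [h0, hd.self]; exact hD₀⟩
  set m := Nat.findGreatest P M with hm
  have hmM : m ≤ M := Nat.findGreatest_le M
  obtain ⟨j, hj, hjm⟩ : P m := Nat.findGreatest_spec (Nat.zero_le M) hP0
  obtain ⟨k, hik, hkn, hkm⟩ : ∃ k, i ≤ k ∧ k ≤ n ∧ d (g m) (p k) ≤ D₀ + 1 := by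
    rcases hmM.eq_or_lt with h | h
    · exact ⟨n, hi, le_rfl, by rw [h, hM, hd.self]; linarith⟩
    · obtain ⟨k, hk, hk'⟩ := hnear' (m + 1) h
      have hnot : ¬ P (m + 1) := Nat.findGreatest_is_greatest (Nat.lt_succ_self m) h
      refine ⟨k, ?_, hk, ?_⟩
      · by_contra hlt
        exact hnot ⟨k, by omega, hk'⟩
      · have h1 := hd.triangle (g m) (g (m + 1)) (p k)
        have h2 := hg m (m + 1) (by omega) h
        push_cast at h2
        linarith
  have hjk : d (p j) (p k) ≤ 2 * D₀ + 1 := by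
    have := hd.triangle (p j) (g m) (p k)
    rw [hd.symm (p j) (g m)] at this
    linarith
  have h1 := hp.sub_le hL (hj.trans hik) hkn hjk
  have h2 := (hp j i hj hi).2
  have hik' : (i : ℝ) ≤ k := by exact_mod_cast hik
  have h3 : L * ((i : ℝ) - j) ≤ L * (L * (2 * D₀ + 1 + C)) :=
    mul_le_mul_of_nonneg_left (by linarith) (by linarith)
  have h4 := hd.triangle (p i) (p j) (g m)
  rw [hd.symm (p i) (p j), hd.symm (p j) (g m)] at h4
  have h5 := hd.triangle (p 0) (g m) (p i)
  have h6 := hd.triangle (p n) (g m) (p i)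
  rw [hd.symm (g m) (p i)] at h5 h6
  have h7 := hg 0 m (Nat.zero_le _) hmM
  have h8 := hg m M hmM le_rfl
  have h9 := hg 0 M (Nat.zero_le _) le_rfl
  rw [h0] at h7 h9
  rw [hM] at h8 h9
  rw [hd.symm] at h8
  unfold gromovProduct
  push_cast at h7 h9
  linarith

/-- Let `q` be a geodesic in `X` and `f` a quasi-isometric embedding into a hyperbolic space. If
`f v` is close to a geodesic between the images of the end points of `q`, then `v` is close to
`q`. -/
lemma GromovInequality.exists_near_of_gromovProduct_le {X Y : Type*} {dX : X → X → ℝ}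
    {dY : Y → Y → ℝ} {δ : ℝ} (hY : IsDiscreteGeodesic dY)
    (H : GromovInequality dY δ) {f : X → Y} {L C : ℝ} (hL : 1 ≤ L)
    (hC : 0 ≤ C)
    (hf : ∀ x x', L⁻¹ * dX x x' - C ≤ dY (f x) (f x') ∧ dY (f x) (f x') ≤ L * dX x x' + C)
    (D : ℝ) {q : ℕ → X} {n : ℕ} (hq : IsQuasiGeodesic dY L C (fun i => f (q i)) n)
    (hqD : ∀ i ≤ n, gromovProduct dY (f (q i)) (f (q 0)) (f (q n)) ≤ D) {v : X}
    (hv : gromovProduct dY (f v) (f (q 0)) (f (q n)) ≤ D) :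
    ∃ j ≤ n, dX v (q j) ≤ L * (4 * D + L + C + 2 * δ + C) := by
  classical
  -- The last such `j` puts `f (q j)` at nearly the same distance from `f (q 0)` as `f v`. Both are
  -- near one geodesic, so the four-point inequality makes them close.
  let P : ℕ → Prop := fun j => dY (f (q 0)) (f (q j)) ≤ dY (f (q 0)) (f v)
  have hP0 : P 0 := by
    change dY _ _ ≤ _
    rw [hY.self]
    exact hY.nonneg _ _
  set j := Nat.findGreatest P n with hjdef
  have hjn : j ≤ n := Nat.findGreatest_le n
  have hPj : P j := Nat.findGreatest_spec (Nat.zero_le n) hP0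
  have h1 := hqD j hjn
  unfold gromovProduct at h1 hv
  have h2 := hY.symm (f (q 0)) (f v)
  have h3 := hY.symm (f (q n)) (f v)
  have h4 := hY.symm (f (q 0)) (f (q j))
  have hD : 0 ≤ D := by
    have := hY.triangle (f (q 0)) (f v) (f (q n))
    linarith
  have hlow : dY (f (q 0)) (f v) - (L + C + 2 * D) ≤ dY (f (q 0)) (f (q j)) := by
    rcases hjn.eq_or_lt with h | h
    · rw [h]
      have := hY.nonneg (f (q n)) (f v)
      linarith
    · have hnot : ¬ P (j + 1) := Nat.findGreatest_is_greatest (Nat.lt_succ_self j) h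
      have h5 : dY (f (q 0)) (f v) < dY (f (q 0)) (f (q (j + 1))) := not_le.1 hnot
      have h6 := hY.triangle (f (q 0)) (f (q j)) (f (q (j + 1)))
      have h7 := (hq j (j + 1) (by omega) h).2
      push_cast at h7
      have : L * ((j : ℝ) + 1 - j) = L := by ring
      linarith
  have hPj' : dY (f (q 0)) (f (q j)) ≤ dY (f (q 0)) (f v) := hPj
  have hnear : dY (f v) (f (q j)) ≤ 4 * D + L + C + 2 * δ := by
    have h5 := H.four_point (f v) (f (q 0)) (f (q j)) (f (q n))
    have h6 := hY.symm (f (q n)) (f (q j))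
    rcases le_max_iff.1 (by linarith : dY (f v) (f (q j)) + dY (f (q 0)) (f (q n)) - 2 * δ ≤ _)
      with h7 | h7 <;> linarith
  refine ⟨j, hjn, ?_⟩
  have h5 := (hf v (q j)).1
  have h6 : L⁻¹ * dX v (q j) ≤ 4 * D + L + C + 2 * δ + C := by linarith
  rwa [inv_mul_le_iff₀ (by linarith)] at h6

/-! ### Slim triangles and transfer of hyperbolicity -/

/-- Triangles are `D`-slim: each point of a geodesic from `x` to `y` is within `D` of a point
between `x` and `z` or of a point between `z` and `y`. -/
def HasSlimTriangles {X : Type*} (d : X → X → ℝ) (D : ℝ) : Prop :=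
  ∀ (p : ℕ → X) (n : ℕ) (z : X), (∀ i j, i ≤ j → j ≤ n → d (p i) (p j) = (j : ℝ) - i) →
    ∀ i ≤ n, ∃ u, d (p i) u ≤ D ∧
      (d (p 0) u + d u z = d (p 0) z ∨ d z u + d u (p n) = d z (p n))

/-- At the last index where `p` is near the side from `p 0` to `w`, it is also near the side from
`w` to `p n`. A point near both sides has distance to `w` at most the Gromov product plus a
constant. -/
lemma HasSlimTriangles.exists_path_near {X : Type*} {d : X → X → ℝ} {D : ℝ}
    (hd : IsDiscreteGeodesic d) (hD : 0 ≤ D) (h : HasSlimTriangles d D) (p : ℕ → X) (n : ℕ)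
    (w : X) (hp : ∀ i j, i ≤ j → j ≤ n → d (p i) (p j) = (j : ℝ) - i) :
    ∃ i ≤ n, d (p i) w ≤ gromovProduct d w (p 0) (p n) + 2 * D + 1 := by
  classical
  let P : ℕ → Prop := fun i => ∃ u, d (p i) u ≤ D ∧ d (p 0) u + d u w = d (p 0) w
  have hP0 : P 0 := ⟨p 0, by rw [hd.self]; exact hD, by rw [hd.self]; ring⟩
  set i := Nat.findGreatest P n with hidef
  have hin : i ≤ n := Nat.findGreatest_le n
  obtain ⟨u, hu, hu'⟩ : P i := Nat.findGreatest_spec (Nat.zero_le n) hP0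
  obtain ⟨v, hv, hv'⟩ : ∃ v, d (p i) v ≤ D + 1 ∧ d w v + d v (p n) = d w (p n) := by
    rcases hin.eq_or_lt with h1 | h1
    · exact ⟨p n, by rw [h1, hd.self]; linarith, by rw [hd.self]; ring⟩
    · have hnot : ¬ P (i + 1) := Nat.findGreatest_is_greatest (Nat.lt_succ_self i) h1
      obtain ⟨v, hv, hv' | hv'⟩ := h p n w hp (i + 1) h1
      · exact absurd ⟨v, hv, hv'⟩ hnot
      · refine ⟨v, ?_, hv'⟩
        have h2 := hd.triangle (p i) (p (i + 1)) v
        have h3 := hp i (i + 1) (by omega) h1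
        push_cast at h3
        linarith
  refine ⟨i, hin, ?_⟩
  have h1 := hd.triangle (p 0) u (p i)
  have h2 := hd.triangle (p i) u w
  have h3 := hd.triangle (p i) v w
  have h4 := hd.triangle (p i) v (p n)
  have h5 := hd.triangle (p 0) (p i) (p n)
  have h6 := hd.symm (p i) u
  have h7 := hd.symm w v
  have h8 := hd.symm w (p n)
  unfold gromovProduct
  linarith

/-- Some point of a geodesic from `x` to `z` almost realizes the Gromov product `(x | z)_w`. By
slimness it is near a point between `x` and `y` or between `y` and `z`, whose distance to `w` is at
least the product for that side. -/
lemma HasSlimTriangles.isGromovHyperbolic {X : Type*} {d : X → X → ℝ} {D : ℝ}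
    (hd : IsDiscreteGeodesic d) (hD : 0 ≤ D) (h : HasSlimTriangles d D) :
    IsGromovHyperbolic d := by
  refine ⟨3 * D + 1, fun w x y z => ?_⟩
  obtain ⟨n, p, rfl, rfl, hp⟩ := hd.exists_path x z
  obtain ⟨i, hi, hiw⟩ := h.exists_path_near hd hD p n w hp
  obtain ⟨u, hu, hu'⟩ := h p n y hp i hi
  have h1 := hd.triangle u (p i) w
  have h2 := hd.symm u (p i)
  have h3 := hd.triangle (p 0) u w
  have h4 := hd.triangle y u w
  have h5 := hd.triangle (p n) u w
  have h6 := hd.symm u y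
  have h7 := hd.symm u (p n)
  suffices min (gromovProduct d w (p 0) y) (gromovProduct d w y (p n)) ≤ d u w by linarith
  rcases hu' with hu' | hu'
  · refine (min_le_left _ _).trans ?_
    unfold gromovProduct
    linarith
  · refine (min_le_right _ _).trans ?_
    unfold gromovProduct
    linarith

/-- A discretely geodesic space that embeds quasi-isometrically into a discretely geodesic
hyperbolic space is hyperbolic. -/
theorem IsQuasiIsometricEmbedding.isGromovHyperbolic {X Y : Type*} {dX : X → X → ℝ}
    {dY : Y → Y → ℝ} {f : X → Y} (hf : IsQuasiIsometricEmbedding dX dY f)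
    (hX : IsDiscreteGeodesic dX) (hY : IsDiscreteGeodesic dY) (h : IsGromovHyperbolic dY) :
    IsGromovHyperbolic dX := by
  obtain ⟨L, C, hL, hC, hf⟩ := hf
  obtain ⟨δ, hδ, H⟩ := h.exists_nonneg
  obtain ⟨D, hD⟩ := H.exists_gromovProduct_quasiGeodesic_le hY hδ L C hL hC
  have hquasi : ∀ (p : ℕ → X) (n : ℕ),
      (∀ i j, i ≤ j → j ≤ n → dX (p i) (p j) = (j : ℝ) - i) →
      IsQuasiGeodesic dY L C (fun i => f (p i)) n := by
    intro p n hp i j hij hj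
    have := hf (p i) (p j)
    rwa [hp i j hij hj] at this
  set E := L * (4 * (D + δ) + L + C + 2 * δ + C) with hE
  have hproj : ∀ a b v : X, gromovProduct dY (f v) (f a) (f b) ≤ D + δ →
      ∃ u, dX v u ≤ E ∧ dX a u + dX u b = dX a b := by
    intro a b v hv
    obtain ⟨n, q, rfl, rfl, hq⟩ := hX.exists_path a b
    have hq' := hquasi q n hq
    obtain ⟨j, hj, hj'⟩ := H.exists_near_of_gromovProduct_le hY hL hC hf (D + δ) hq'
      (fun i hi => (hD _ n hq' i hi).trans (by linarith)) hv
    refine ⟨q j, hj', ?_⟩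
    rw [hq 0 j (Nat.zero_le _) hj, hq j n hj le_rfl, hq 0 n (Nat.zero_le _) le_rfl]
    ring
  refine HasSlimTriangles.isGromovHyperbolic hX (le_max_right E 0) fun p n z hp i hi => ?_
  have h1 := hD _ n (hquasi p n hp) i hi
  -- Hyperbolicity in `Y` passes the bound `D` to one of the other two sides at the cost of `δ`;
  -- `hproj` pulls this back to `X`.
  have h2 := H (f (p i)) (f (p 0)) (f z) (f (p n))
  rcases min_le_iff.1 (by linarith : min (gromovProduct dY (f (p i)) (f (p 0)) (f z))
      (gromovProduct dY (f (p i)) (f z) (f (p n))) ≤ D + δ) with h3 | h3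
  · obtain ⟨u, hu, hu'⟩ := hproj _ _ _ h3
    exact ⟨u, hu.trans (le_max_left _ _), Or.inl hu'⟩
  · obtain ⟨u, hu, hu'⟩ := hproj _ _ _ h3
    exact ⟨u, hu.trans (le_max_left _ _), Or.inr hu'⟩

/-! ### Word lengths and word metrics -/

section WordLength

variable {G : Type*} [Group G] {S : Set G}

lemma wordLength_prod_le {l : List G} (hl : ∀ x ∈ l, x ∈ S ∨ x⁻¹ ∈ S) :
    wordLength S l.prod ≤ l.length :=
  Nat.sInf_le ⟨l, rfl, hl, rfl⟩

lemma exists_list_length_eq_wordLength (hS : Subgroup.closure S = ⊤) (g : G) :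
    ∃ l : List G, l.length = wordLength S g ∧ (∀ x ∈ l, x ∈ S ∨ x⁻¹ ∈ S) ∧ l.prod = g := by
  obtain ⟨l, hl, hg⟩ := Submonoid.exists_list_of_mem_closure (s := S ∪ S⁻¹) (x := g) (by
    rw [← Subgroup.closure_toSubmonoid, hS]
    trivial)
  exact Nat.sInf_mem (s := {n : ℕ | ∃ l : List G, l.length = n ∧
    (∀ x ∈ l, x ∈ S ∨ x⁻¹ ∈ S) ∧ l.prod = g}) ⟨_, l, rfl, hl, hg⟩

lemma wordLength_one : wordLength S (1 : G) = 0 :=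
  Nat.le_zero.1 (wordLength_prod_le (S := S) (l := []) (by simp))

lemma wordLength_mul_le (hS : Subgroup.closure S = ⊤) (g h : G) :
    wordLength S (g * h) ≤ wordLength S g + wordLength S h := by
  obtain ⟨l, hl, hlS, rfl⟩ := exists_list_length_eq_wordLength hS g
  obtain ⟨k, hk, hkS, rfl⟩ := exists_list_length_eq_wordLength hS h
  rw [← hl, ← hk, ← List.length_append, ← List.prod_append]
  refine wordLength_prod_le fun x hx => ?_
  rcases List.mem_append.1 hx with hx | hx
  exacts [hlS x hx, hkS x hx]

lemma wordLength_inv_le (hS : Subgroup.closure S = ⊤) (g : G) :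
    wordLength S g⁻¹ ≤ wordLength S g := by
  obtain ⟨l, hl, hlS, rfl⟩ := exists_list_length_eq_wordLength hS g
  rw [← hl, List.prod_inv_reverse]
  refine (wordLength_prod_le fun x hx => ?_).trans_eq (by simp)
  simp only [List.mem_reverse, List.mem_map] at hx
  obtain ⟨y, hy, rfl⟩ := hx
  rw [inv_inv]
  exact (hlS y hy).symm

lemma wordLength_inv (hS : Subgroup.closure S = ⊤) (g : G) :
    wordLength S g⁻¹ = wordLength S g :=
  le_antisymm (wordLength_inv_le hS g) (by simpa using wordLength_inv_le hS g⁻¹)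

lemma isDiscreteGeodesic_wordDist (hS : Subgroup.closure S = ⊤) :
    IsDiscreteGeodesic (wordDist S) where
  self x := by simp [wordDist, wordLength_one]
  symm x y := by
    unfold wordDist
    rw [← wordLength_inv hS, mul_inv_rev, inv_inv]
  triangle x y z := by
    unfold wordDist
    have := wordLength_mul_le hS (x⁻¹ * y) (y⁻¹ * z)
    rw [show x⁻¹ * y * (y⁻¹ * z) = x⁻¹ * z by group] at this
    exact_mod_cast this
  exists_path x y := by
    obtain ⟨l, hl, hlS, hlp⟩ := exists_list_length_eq_wordLength hS (x⁻¹ * y)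
    refine ⟨l.length, fun i => x * (l.take i).prod, by simp, by simp [hlp], ?_⟩
    intro i j hij hj
    -- Subwords bound distances between prefixes from above; equality holds because a saving
    -- anywhere would shorten the minimal word `l`.
    have hsub : ∀ i j, i ≤ j → j ≤ l.length →
        wordLength S ((l.take i).prod⁻¹ * (l.take j).prod) ≤ j - i := by
      intro i j hij hj
      have h1 : (l.take i).prod⁻¹ * (l.take j).prod = ((l.take j).drop i).prod := by
        rw [inv_mul_eq_iff_eq_mul]
        conv_lhs => rw [← List.take_append_drop i (l.take j), List.prod_append,
          List.take_take, min_eq_left hij]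
      rw [h1]
      refine (wordLength_prod_le fun x hx => hlS x ?_).trans (by simp [hj])
      exact List.mem_of_mem_take (List.mem_of_mem_drop hx)
    have h1 := hsub i j hij hj
    have h2 := hsub 0 i (Nat.zero_le _) (hij.trans hj)
    have h3 := hsub j l.length hj le_rfl
    simp only [List.take_zero, List.prod_nil, inv_one, one_mul, List.take_length] at h2 h3
    have h4 := wordLength_mul_le hS ((l.take i).prod)
      ((l.take i).prod⁻¹ * (l.take j).prod * ((l.take j).prod⁻¹ * l.prod))
    have h5 := wordLength_mul_le hS ((l.take i).prod⁻¹ * (l.take j).prod)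
      ((l.take j).prod⁻¹ * l.prod)
    rw [show (l.take i).prod * ((l.take i).prod⁻¹ * (l.take j).prod *
      ((l.take j).prod⁻¹ * l.prod)) = l.prod by group, hlp, ← hl] at h4
    have h6 : wordLength S ((l.take i).prod⁻¹ * (l.take j).prod) = j - i := by
      rw [hlp] at h3 h5
      omega
    unfold wordDist
    rw [show (x * (l.take i).prod)⁻¹ * (x * (l.take j).prod) =
      (l.take i).prod⁻¹ * (l.take j).prod by group, h6, Nat.cast_sub hij]

/-- A homomorphism that is bounded on a generating set is Lipschitz for the word metrics. -/
lemma wordLength_map_le {H : Type*} [Group H] {T : Set H} (hT : Subgroup.closure T = ⊤)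
    (hS : Subgroup.closure S = ⊤) (φ : H →* G) (N : ℕ)
    (hN : ∀ t ∈ T, wordLength S (φ t) ≤ N) (h : H) :
    wordLength S (φ h) ≤ N * wordLength T h := by
  obtain ⟨l, hl, hlT, rfl⟩ := exists_list_length_eq_wordLength hT h
  rw [← hl]
  clear hl
  induction l with
  | nil => simp [wordLength_one]
  | cons a l ih =>
    have h1 := ih fun x hx => hlT x (List.mem_cons_of_mem _ hx)
    have h2 : wordLength S (φ a) ≤ N := by
      rcases hlT a List.mem_cons_self with ha | ha
      · exact hN a ha
      · have := hN _ ha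
        rwa [map_inv, wordLength_inv hS] at this
    have h3 := wordLength_mul_le hS (φ a) (φ l.prod)
    rw [List.prod_cons, map_mul, List.length_cons, Nat.mul_succ]
    omega

lemma mem_pow_of_wordLength (hS : Subgroup.closure S = ⊤) (g : G) :
    g ∈ (S ∪ S⁻¹) ^ wordLength S g := by
  obtain ⟨l, hl, hlS, rfl⟩ := exists_list_length_eq_wordLength hS g
  rw [← hl]
  clear hl
  induction l with
  | nil => simp
  | cons a l ih =>
    rw [List.prod_cons, List.length_cons, pow_succ']
    refine Set.mul_mem_mul ?_ (ih fun x hx => hlS x (List.mem_cons_of_mem _ hx))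
    rcases hlS a List.mem_cons_self with h | h
    exacts [Or.inl h, Or.inr h]

lemma wordLength_le_of_mem_pow (n : ℕ) {g : G} (hg : g ∈ (S ∪ S⁻¹) ^ n) :
    wordLength S g ≤ n := by
  suffices ∃ l : List G, l.length = n ∧ (∀ x ∈ l, x ∈ S ∨ x⁻¹ ∈ S) ∧ l.prod = g from
    Nat.sInf_le this
  induction n generalizing g with
  | zero => exact ⟨[], by simp_all⟩
  | succ n ih =>
    rw [pow_succ'] at hg
    obtain ⟨a, ha, b, hb, rfl⟩ := hg
    obtain ⟨l, hl, hlS, rfl⟩ := ih hb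
    refine ⟨a :: l, by simp [hl], fun x hx => ?_, by simp⟩
    rcases List.mem_cons.1 hx with rfl | hx
    exacts [ha, hlS x hx]

lemma finite_wordLength_le (hS : Subgroup.closure S = ⊤) (hfin : S.Finite) (n : ℕ) :
    {g : G | wordLength S g ≤ n}.Finite := by
  have hpow : ∀ k : ℕ, ((S ∪ S⁻¹) ^ k).Finite := by
    intro k
    induction k with
    | zero => simp
    | succ k ih =>
      rw [pow_succ]
      exact ih.mul (hfin.union hfin.inv)
  refine (Set.Finite.biUnion (Set.finite_Iic n) fun k _ => hpow k).subset fun g hg => ?_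
  exact Set.mem_biUnion (Set.mem_Iic.2 hg) (mem_pow_of_wordLength hS g)

end WordLength

lemma IsQuasiIsometricEmbedding.comp {X Y Z : Type*} {dX : X → X → ℝ} {dY : Y → Y → ℝ}
    {dZ : Z → Z → ℝ} {g : Y → Z} {f : X → Y} (hg : IsQuasiIsometricEmbedding dY dZ g)
    (hf : IsQuasiIsometricEmbedding dX dY f) : IsQuasiIsometricEmbedding dX dZ (g ∘ f) := by
  obtain ⟨L, C, hL, hC, hf⟩ := hf
  obtain ⟨L', C', hL', hC', hg⟩ := hg
  refine ⟨L' * L, L' * C + C', by nlinarith, by positivity, fun x x' => ?_⟩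
  obtain ⟨h1, h2⟩ := hf x x'
  obtain ⟨h3, h4⟩ := hg (f x) (f x')
  constructor
  · have h5 : L'⁻¹ * (L⁻¹ * dX x x' - C) ≤ L'⁻¹ * dY (f x) (f x') :=
      mul_le_mul_of_nonneg_left h1 (by positivity)
    have h6 : L'⁻¹ * C ≤ L' * C :=
      mul_le_mul_of_nonneg_right ((inv_le_one_of_one_le₀ hL').trans hL') hC
    rw [mul_inv]
    simp only [Function.comp_apply]
    linarith
  · have h5 : L' * dY (f x) (f x') ≤ L' * (L * dX x x' + C) :=
      mul_le_mul_of_nonneg_left h2 (by positivity)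
    simp only [Function.comp_apply]
    linarith

lemma isQuasiIsometricEmbedding_wordDist_of_le {G H : Type*} [Group G] [Group H] {S : Set G}
    {T : Set H} (φ : H →* G) (N : ℕ)
    (h₁ : ∀ h, wordLength S (φ h) ≤ N * wordLength T h)
    (h₂ : ∀ h, wordLength T h ≤ N * wordLength S (φ h) + N) :
    IsQuasiIsometricEmbedding (wordDist T) (wordDist S) φ := by
  have hpos : (0 : ℝ) < N + 1 := by positivity
  -- `N + 1` keeps the multiplicative constant at least `1` when `N = 0`.
  refine ⟨N + 1, 1, by simp, zero_le_one, fun x x' => ?_⟩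
  unfold wordDist
  have h3 := h₁ (x⁻¹ * x')
  have h4 := h₂ (x⁻¹ * x')
  rw [map_mul, map_inv] at h3 h4
  have h5 : (wordLength S ((φ x)⁻¹ * φ x') : ℝ) ≤ N * wordLength T (x⁻¹ * x') := by
    exact_mod_cast h3
  have h6 : (wordLength T (x⁻¹ * x') : ℝ) ≤ N * wordLength S ((φ x)⁻¹ * φ x') + N := by
    exact_mod_cast h4
  have h7 : (0 : ℝ) ≤ wordLength S ((φ x)⁻¹ * φ x') := Nat.cast_nonneg _
  have h8 : (0 : ℝ) ≤ wordLength T (x⁻¹ * x') := Nat.cast_nonneg _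
  constructor
  · rw [sub_le_iff_le_add, inv_mul_le_iff₀ hpos]
    linarith
  · linarith

lemma Subgroup.finite_preimage_isCompact {G : Type*} [Group G] [TopologicalSpace G]
    [IsTopologicalGroup G] [T2Space G] (Γ : Subgroup G) [DiscreteTopology Γ]
    {K : Set G} (hK : IsCompact K) : {γ : Γ | (γ : G) ∈ K}.Finite := by
  have : IsCompact ((↑) ⁻¹' K : Set Γ) :=
    (Subgroup.isClosed_of_discrete (H := Γ)).isClosedEmbedding_subtypeVal.isCompact_preimage hK
  exact isCompact_iff_finite.1 this

/-! ### Compact generation and uniform lattices -/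

section Topological

variable {G : Type*} [Group G] [TopologicalSpace G] [IsTopologicalGroup G]
  [LocallyCompactSpace G]

/-- Compact sets have bounded word length with respect to a compact generating set. -/
lemma IsCompactGeneratingSet.exists_wordLength_le [T2Space G] {S : Set G}
    (hS : IsCompactGeneratingSet S) {K : Set G} (hK : IsCompact K) :
    ∃ N, ∀ g ∈ K, wordLength S g ≤ N := by
  have hcomp : ∀ n : ℕ, IsCompact ((S ∪ S⁻¹) ^ n) := by
    intro n
    induction n with
    | zero => simp
    | succ n ih =>
      rw [pow_succ]
      exact ih.mul (hS.1.union hS.1.inv)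
  -- By Baire, the elements given by words of some length `n` have interior; its translates cover
  -- `K`.
  obtain ⟨n, x, hx⟩ := nonempty_interior_of_iUnion_of_closed (fun n => (hcomp n).isClosed)
    (Set.eq_univ_of_forall fun g => Set.mem_iUnion.2 ⟨_, mem_pow_of_wordLength hS.2 g⟩)
  refine hK.induction_on (p := fun K => ∃ N, ∀ g ∈ K, wordLength S g ≤ N) ⟨0, by simp⟩
    (fun s t hst ⟨N, hN⟩ => ⟨N, fun g hg => hN g (hst hg)⟩) ?_ ?_
  · rintro s t ⟨N, hN⟩ ⟨M, hM⟩
    refine ⟨max N M, fun g hg => ?_⟩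
    rcases hg with hg | hg
    exacts [(hN g hg).trans (le_max_left _ _), (hM g hg).trans (le_max_right _ _)]
  · intro k _
    refine ⟨(fun g => x * k⁻¹ * g) ⁻¹' interior ((S ∪ S⁻¹) ^ n), mem_nhdsWithin_of_mem_nhds ?_,
      wordLength S (x * k⁻¹) + n, fun g hg => ?_⟩
    · refine (continuous_const_mul (x * k⁻¹)).continuousAt.preimage_mem_nhds ?_
      rw [inv_mul_cancel_right]
      exact isOpen_interior.mem_nhds hx
    · have h1 : wordLength S (x * k⁻¹ * g) ≤ n :=
        wordLength_le_of_mem_pow n (interior_subset hg)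
      have h2 := wordLength_mul_le hS.2 (x * k⁻¹)⁻¹ (x * k⁻¹ * g)
      rw [inv_mul_cancel_left, wordLength_inv hS.2] at h2
      omega

/-- Each generating set is compact, hence bounded in the other word length. This frees hyperbolicity
of `G` from the generating set for which it is given. -/
lemma IsCompactGeneratingSet.isQuasiIsometricEmbedding_id [T2Space G] {S S' : Set G}
    (hS : IsCompactGeneratingSet S) (hS' : IsCompactGeneratingSet S') :
    IsQuasiIsometricEmbedding (wordDist S) (wordDist S') (id : G → G) := by
  obtain ⟨N, hN⟩ := hS'.exists_wordLength_le hS.1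
  obtain ⟨M, hM⟩ := hS.exists_wordLength_le hS'.1
  refine isQuasiIsometricEmbedding_wordDist_of_le (MonoidHom.id G) (N + M) (fun h => ?_)
    fun h => ?_
  · exact (wordLength_map_le hS.2 hS'.2 (MonoidHom.id G) N hN h).trans
      (Nat.mul_le_mul_right _ (Nat.le_add_right _ _))
  · exact (wordLength_map_le hS'.2 hS.2 (MonoidHom.id G) M hM h).trans
      ((Nat.mul_le_mul_right _ (Nat.le_add_left _ _)).trans (Nat.le_add_right _ _))

/-- A cocompact subgroup has a compact set of coset representatives. -/
lemma Subgroup.exists_isCompact_mul_eq_univ (Γ : Subgroup G) [CompactSpace (G ⧸ Γ)] :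
    ∃ K : Set G, IsCompact K ∧ ∀ g : G, ∃ k ∈ K, ∃ γ : Γ, g = k * γ := by
  choose K hK hKn using fun g : G => exists_compact_mem_nhds g
  obtain ⟨t, -, ht⟩ := (isCompact_univ (X := G ⧸ Γ)).elim_nhds_subcover
    (fun x => (QuotientGroup.mk : G → G ⧸ Γ) '' K x.out) fun x _ => by
      have := (QuotientGroup.isOpenMap_coe (N := Γ)).image_mem_nhds (hKn x.out)
      rwa [QuotientGroup.out_eq'] at this
  refine ⟨⋃ x ∈ t, K x.out, t.finite_toSet.isCompact_biUnion fun x _ => hK _, fun g => ?_⟩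
  obtain ⟨x, hx, k, hk, hkg⟩ := Set.mem_iUnion₂.1 (ht (Set.mem_univ (g : G ⧸ Γ)))
  refine ⟨k, Set.mem_biUnion hx hk, ⟨k⁻¹ * g, QuotientGroup.eq.1 hkg⟩, by simp⟩

/-- Uniform lattices are undistorted. -/
theorem IsUniformSubgroup.isUndistorted [T2Space G] {Γ : Subgroup G} [DiscreteTopology Γ]
    (hΓ : IsUniformSubgroup Γ) {S : Set G} (hS : IsCompactGeneratingSet S) {T : Set Γ}
    (hTfin : T.Finite) (hT : Subgroup.closure T = ⊤) : IsUndistorted S Γ T := by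
  have : CompactSpace (G ⧸ Γ) := hΓ
  obtain ⟨K, hK, hKΓ⟩ := Γ.exists_isCompact_mul_eq_univ
  obtain ⟨M, hM⟩ := (hTfin.image fun t : Γ => wordLength S (t : G)).bddAbove
  -- Adding `1` to `A` and to `K` lets the two ends of a word be treated like its interior letters.
  set A := insert 1 (S ∪ S⁻¹) with hA
  have hAc : IsCompact A := (hS.1.union hS.1.inv).insert 1
  set K₁ := insert 1 K with hK₁
  have hK₁c : IsCompact K₁ := hK.insert 1
  obtain ⟨N, hN⟩ := ((Γ.finite_preimage_isCompact ((hK₁c.inv.mul hAc).mul hK₁c)).image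
    (wordLength T)).bddAbove
  have hN' : ∀ γ : Γ, ∀ k ∈ K₁, ∀ a ∈ A, ∀ k' ∈ K₁, (γ : G) = k⁻¹ * a * k' →
      wordLength T γ ≤ N := by
    intro γ k hk a ha k' hk' h
    refine hN ⟨γ, ?_, rfl⟩
    rw [Set.mem_ofPred_eq, h]
    exact Set.mul_mem_mul (Set.mul_mem_mul (Set.inv_mem_inv.2 hk) ha) hk'
  have hlist : ∀ l : List G, (∀ x ∈ l, x ∈ S ∨ x⁻¹ ∈ S) → ∀ k ∈ K₁, ∀ γ : Γ,
      l.prod = k * γ → wordLength T γ ≤ N * l.length + N := by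
    intro l
    induction l with
    | nil =>
      intro _ k hk γ h
      have : wordLength T γ ≤ N := hN' γ k hk 1 (Set.mem_insert _ _) 1 (Set.mem_insert _ _) (by
        rw [mul_one, mul_one]
        exact eq_inv_of_mul_eq_one_right h.symm)
      simpa using this
    | cons a l ih =>
      intro hl k hk γ h
      -- Round the remaining suffix to `Γ`; then `γ * γ'⁻¹ = k⁻¹ * a * k'` lies in a fixed finite
      -- set.
      obtain ⟨k', hk', γ', hγ'⟩ := hKΓ l.prod
      have h1 := ih (fun x hx => hl x (List.mem_cons_of_mem _ hx)) k' (Set.mem_insert_of_mem _ hk')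
        γ' hγ'
      have h2 : wordLength T (γ * γ'⁻¹) ≤ N := by
        refine hN' _ k hk a (Set.mem_insert_of_mem _ (hl a List.mem_cons_self)) k'
          (Set.mem_insert_of_mem _ hk') ?_
        rw [List.prod_cons, hγ'] at h
        push_cast
        rw [eq_inv_mul_of_mul_eq h.symm]
        group
      have h3 := wordLength_mul_le hT (γ * γ'⁻¹) γ'
      rw [inv_mul_cancel_right] at h3
      rw [List.length_cons, Nat.mul_succ]
      omega
  refine isQuasiIsometricEmbedding_wordDist_of_le Γ.subtype (M + N) (fun γ => ?_) fun γ => ?_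
  · exact (wordLength_map_le hT hS.2 Γ.subtype M (fun t ht => hM ⟨t, ht, rfl⟩) γ).trans
      (Nat.mul_le_mul_right _ (Nat.le_add_right _ _))
  · obtain ⟨l, hl, hlS, hlγ⟩ := exists_list_length_eq_wordLength hS.2 (γ : G)
    have := hlist l hlS 1 (Set.mem_insert _ _) γ (by rw [hlγ, one_mul])
    rw [hl] at this
    refine this.trans (Nat.add_le_add (Nat.mul_le_mul_right _ (Nat.le_add_left _ _))
      (Nat.le_add_left _ _))

/-- Undistorted subgroups of hyperbolic groups are hyperbolic. -/
theorem IsUndistorted.isGromovHyperbolic [T2Space G] (hG : IsGromovHyperbolicGroup G)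
    {Γ : Subgroup G} {S : Set G} (hS : IsCompactGeneratingSet S) {T : Set Γ}
    (hT : Subgroup.closure T = ⊤) (h : IsUndistorted S Γ T) :
    IsGromovHyperbolic (wordDist T) := by
  obtain ⟨S₀, hS₀, hhyp⟩ := hG
  exact ((hS.isQuasiIsometricEmbedding_id hS₀).comp h).isGromovHyperbolic
    (isDiscreteGeodesic_wordDist hT) (isDiscreteGeodesic_wordDist hS₀.2) hhyp

end Topological

/-! ### Finite subgroups of hyperbolic groups -/

/-- The quasi-centre of a finite subgroup has small diameter. -/
lemma exists_wordLength_conj_le {Γ : Type*} [Group Γ] {T : Set Γ}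
    (hT : Subgroup.closure T = ⊤) {δ : ℝ} (H : GromovInequality (wordDist T) δ)
    (F : Subgroup Γ) [Finite F] :
    ∃ x : Γ, ∀ f ∈ F, (wordLength T (x⁻¹ * (f * x)) : ℝ) ≤ 4 * δ + 1 := by
  classical
  have hd := isDiscreteGeodesic_wordDist hT
  have := Fintype.ofFinite F
  -- `R x` is the radius of `F` seen from `x`. A minimizer `x` is a quasi-centre, and so is `f * x`.
  let R : Γ → ℕ := fun x => Finset.univ.sup fun y : F => wordLength T (x⁻¹ * y)
  have hR : ∀ (x : Γ) (y : F), wordDist T (y : Γ) x ≤ R x := by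
    intro x y
    rw [hd.symm]
    exact Nat.cast_le.2 (Finset.le_sup (f := fun y : F => wordLength T (x⁻¹ * y))
      (Finset.mem_univ y))
  obtain ⟨x, hx⟩ : ∃ x, ∀ x', R x ≤ R x' :=
    ⟨Function.argmin R, fun x' => Function.argmin_le R x'⟩
  refine ⟨x, fun f hf => ?_⟩
  have hRf : R (f * x) ≤ R x := by
    refine Finset.sup_le fun y _ => ?_
    rw [mul_inv_rev, mul_assoc]
    exact Finset.le_sup (f := fun y : F => wordLength T (x⁻¹ * y))
      (Finset.mem_univ ((⟨f, hf⟩ : F)⁻¹ * y))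
  obtain ⟨n, p, h0, hn, hp⟩ := hd.exists_path x (f * x)
  -- The midpoint of a long geodesic from `x` to `f * x` would have smaller radius; the `1` in `4 *
  -- δ + 1` absorbs the parity of `n`.
  obtain ⟨k, hk₁, hk₂⟩ : ∃ k, n ≤ 2 * k + 1 ∧ 2 * k ≤ n := ⟨n / 2, by omega, by omega⟩
  have hkn : k ≤ n := by omega
  obtain ⟨y, -, hy⟩ := Finset.exists_mem_eq_sup (Finset.univ : Finset F) ⟨1, Finset.mem_univ _⟩
    fun y : F => wordLength T ((p k)⁻¹ * y)
  have h1 : (R x : ℝ) ≤ wordDist T (y : Γ) (p k) := by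
    rw [hd.symm]
    have : R x ≤ wordLength T ((p k)⁻¹ * y) := (hx _).trans_eq hy
    exact Nat.cast_le.2 this
  have h2 := H.four_point (y : Γ) x (p k) (f * x)
  have h3 := hR x y
  have h4 : wordDist T (y : Γ) (f * x) ≤ R x := (hR (f * x) y).trans (Nat.cast_le.2 hRf)
  have h5 := hp 0 k (Nat.zero_le _) hkn
  have h6 := hp k n hkn le_rfl
  have h7 := hp 0 n (Nat.zero_le _) le_rfl
  have h8 : (n : ℝ) ≤ 2 * (k : ℝ) + 1 := by
    exact_mod_cast hk₁
  have h9 : 2 * (k : ℝ) ≤ n := by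
    exact_mod_cast hk₂
  rw [h0] at h5 h7
  rw [hn] at h6 h7
  change wordDist T x (f * x) ≤ _
  push_cast at h5 h7
  rcases le_max_iff.1 (by linarith : wordDist T (y : Γ) (p k) + wordDist T x (f * x) - 2 * δ
    ≤ _) with h | h <;> linarith

/-- The finite subgroups of a finitely generated hyperbolic group have bounded order. -/
theorem exists_card_le_of_isGromovHyperbolic {Γ : Type*} [Group Γ] {T : Set Γ}
    (hTfin : T.Finite) (hT : Subgroup.closure T = ⊤) (h : IsGromovHyperbolic (wordDist T)) :
    ∃ N, ∀ F : Subgroup Γ, Finite F → Nat.card F ≤ N := by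
  obtain ⟨δ, -, H⟩ := h.exists_nonneg
  have hfin := finite_wordLength_le hT hTfin ⌊4 * δ + 1⌋₊
  refine ⟨Nat.card {g : Γ | wordLength T g ≤ ⌊4 * δ + 1⌋₊}, fun F _ => ?_⟩
  obtain ⟨x, hx⟩ := exists_wordLength_conj_le hT H F
  have := hfin.to_subtype
  refine Nat.card_le_card_of_injective
    (fun f : F => (⟨x⁻¹ * (f * x), Nat.le_floor (hx f f.2)⟩ :
      {g : Γ | wordLength T g ≤ ⌊4 * δ + 1⌋₊})) fun f f' hff => ?_
  have h1 : x⁻¹ * (f * x) = x⁻¹ * (f' * x) := congrArg Subtype.val hff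
  exact Subtype.ext (mul_right_cancel (mul_left_cancel h1))

/-! ### Compact open subgroups -/

section CompactOpen

variable {G : Type*} [Group G] [TopologicalSpace G] [IsTopologicalGroup G]

/-- Van Dantzig's theorem: in a totally disconnected locally compact group the compact open
subgroups form a basis of neighbourhoods of the identity. -/
theorem exists_compact_open_subgroup_subset [T2Space G] [LocallyCompactSpace G]
    [TotallyDisconnectedSpace G] {O : Set G} (hO : O ∈ nhds (1 : G)) :
    ∃ U : Subgroup G, IsOpen (U : Set G) ∧ IsCompact (U : Set G) ∧ (U : Set G) ⊆ O := by
  obtain ⟨K, hK, hKO, hKc⟩ := local_compact_nhds hO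
  obtain ⟨W, hW, h1W, hWK⟩ := (loc_compact_Haus_tot_disc_of_zero_dim (H := G)).mem_nhds_iff.1 hK
  have hWc : IsCompact W := hKc.of_isClosed_subset hW.1 hWK
  obtain ⟨V, hV, hWV⟩ := compact_open_separated_mul_right hWc hW.2 subset_rfl
  -- The stabilizer of `W` under right translation contains `V ∩ V⁻¹`, so it is open; it lies in `W`
  -- since `1 ∈ W`.
  let U : Subgroup G :=
    { carrier := {g | ∀ x, x * g ∈ W ↔ x ∈ W}
      mul_mem' := fun {a b} ha hb x => by rw [← mul_assoc, hb, ha]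
      one_mem' := fun x => by rw [mul_one]
      inv_mem' := fun {a} ha x => by rw [← ha, inv_mul_cancel_right] }
  have hUnhds : (U : Set G) ∈ nhds (1 : G) := by
    filter_upwards [hV, inv_mem_nhds_one G hV] with g hg hg' x
    refine ⟨fun hx => ?_, fun hx => hWV (Set.mul_mem_mul hx hg)⟩
    have := hWV (Set.mul_mem_mul hx (Set.mem_inv.1 hg'))
    rwa [mul_inv_cancel_right] at this
  have hUo : IsOpen (U : Set G) := U.isOpen_of_mem_nhds hUnhds
  have hUW : (U : Set G) ⊆ W := fun g hg => by
    have := (hg 1).2 h1W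
    rwa [one_mul] at this
  exact ⟨U, hUo, hWc.of_isClosed_subset (U.isClosed_of_isOpen hUo) hUW,
    hUW.trans (hWK.trans hKO)⟩

/-- Coset representatives of an open subgroup of a compact group. -/
lemma exists_finset_coset_representatives {U V : Subgroup G} (hU : IsCompact (U : Set G))
    (hV : IsOpen (V : Set G)) (hVU : V ≤ U) :
    ∃ t : Finset G, (U : Set G) = ⋃ u ∈ t, u • (V : Set G) ∧
      ∀ u ∈ t, ∀ u' ∈ t, u⁻¹ * u' ∈ V → u = u' := by
  classical
  have : CompactSpace U := isCompact_iff_compactSpace.1 hU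
  have := QuotientGroup.discreteTopology (N := V.subgroupOf U)
    (hV.preimage continuous_subtype_val)
  have : Finite (U ⧸ V.subgroupOf U) := finite_of_compact_of_discrete
  have := Fintype.ofFinite (U ⧸ V.subgroupOf U)
  refine ⟨Finset.univ.image fun q : U ⧸ V.subgroupOf U => (q.out : G), ?_, ?_⟩
  · ext g
    simp only [SetLike.mem_coe, Finset.mem_image, Finset.mem_univ, true_and, Set.mem_iUnion,
      exists_prop, Set.mem_smul_set_iff_inv_smul_mem, smul_eq_mul]
    constructor
    · intro hg
      refine ⟨_, ⟨((⟨g, hg⟩ : U) : U ⧸ V.subgroupOf U), rfl⟩, ?_⟩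
      have := QuotientGroup.eq.1 (QuotientGroup.out_eq' ((⟨g, hg⟩ : U) : U ⧸ V.subgroupOf U))
      simpa [Subgroup.mem_subgroupOf] using this
    · rintro ⟨_, ⟨q, rfl⟩, h⟩
      have := U.mul_mem q.out.2 (hVU h)
      rwa [mul_inv_cancel_left] at this
  · simp only [Finset.mem_image, Finset.mem_univ, true_and]
    rintro _ ⟨q, rfl⟩ _ ⟨q', rfl⟩ h
    have : (q.out : U ⧸ V.subgroupOf U) = q'.out :=
      QuotientGroup.eq.2 (by simpa [Subgroup.mem_subgroupOf] using h)
    rw [QuotientGroup.out_eq', QuotientGroup.out_eq'] at this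
    rw [this]

end CompactOpen

/-! ### Volumes of orbits in `G ⧸ Γ` -/

section Lattice

variable {G : Type*} [Group G] [TopologicalSpace G] [IsTopologicalGroup G]

lemma measure_eq_card_mul_of_coset_representatives [MeasurableSpace G] [BorelSpace G]
    (l : Measure G) [l.IsMulLeftInvariant] {U V : Subgroup G} (hV : IsOpen (V : Set G))
    {t : Finset G} (hU : (U : Set G) = ⋃ u ∈ t, u • (V : Set G))
    (ht : ∀ u ∈ t, ∀ u' ∈ t, u⁻¹ * u' ∈ V → u = u') :
    l U = t.card * l V := by
  rw [hU, measure_biUnion_finset]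
  · simp [measure_smul]
  · intro u hu u' hu' hne
    refine Set.disjoint_left.2 fun x hx hx' => hne (ht u hu u' hu' ?_)
    rw [Set.mem_smul_set_iff_inv_smul_mem, smul_eq_mul] at hx hx'
    have := V.mul_mem hx (V.inv_mem hx')
    rwa [show u⁻¹ * x * (u'⁻¹ * x)⁻¹ = u⁻¹ * u' by group] at this
  · exact fun u _ => (hV.smul u).measurableSet

/-- As `U` meets `Γ` trivially, it injects into `G ⧸ Γ`, so distinct cosets of `V` in `U` have
disjoint images. -/
lemma measure_image_mk_eq_card_mul {Γ : Subgroup G} [MeasurableSpace (G ⧸ Γ)]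
    [BorelSpace (G ⧸ Γ)] (μ : Measure (G ⧸ Γ)) [SMulInvariantMeasure G (G ⧸ Γ) μ]
    {U V : Subgroup G} (hV : IsOpen (V : Set G)) (hVU : V ≤ U) (hUΓ : Disjoint U Γ)
    {t : Finset G} (hU : (U : Set G) = ⋃ u ∈ t, u • (V : Set G))
    (ht : ∀ u ∈ t, ∀ u' ∈ t, u⁻¹ * u' ∈ V → u = u') :
    μ ((QuotientGroup.mk : G → G ⧸ Γ) '' U) =
      t.card * μ ((QuotientGroup.mk : G → G ⧸ Γ) '' V) := by
  have himage : (QuotientGroup.mk : G → G ⧸ Γ) '' U =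
      ⋃ u ∈ t, u • ((QuotientGroup.mk : G → G ⧸ Γ) '' V) := by
    rw [hU, Set.image_iUnion₂]
    refine Set.iUnion₂_congr fun u _ => ?_
    exact Set.image_smul_comm _ u _ fun _ => rfl
  have hVo : IsOpen ((QuotientGroup.mk : G → G ⧸ Γ) '' V) := QuotientGroup.isOpenMap_coe _ hV
  have htU : ∀ u ∈ t, u ∈ U := fun u hu => by
    rw [← SetLike.mem_coe, hU]
    exact Set.mem_biUnion hu ⟨1, V.one_mem, mul_one u⟩
  rw [himage, measure_biUnion_finset]
  · simp [measure_smul]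
  · intro u hu u' hu' hne
    refine Set.disjoint_left.2 ?_
    rintro _ ⟨_, ⟨v, hv, rfl⟩, rfl⟩ ⟨_, ⟨v', hv', rfl⟩, h⟩
    refine hne (ht u hu u' hu' ?_)
    have h1 : (u' * v')⁻¹ * (u * v) ∈ Γ := QuotientGroup.eq.1 h
    have h2 : (u' * v')⁻¹ * (u * v) ∈ U :=
      U.mul_mem (U.inv_mem (U.mul_mem (htU u' hu') (hVU hv')))
        (U.mul_mem (htU u hu) (hVU hv))
    have h3 := Subgroup.disjoint_def.1 hUΓ h2 h1
    have h4 : u' * v' = u * v := (inv_mul_eq_one.1 h3)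
    have h5 : u⁻¹ * u' = v * v'⁻¹ := by
      rw [inv_mul_eq_iff_eq_mul, ← mul_assoc, ← h4, mul_inv_cancel_right]
    rw [h5]
    exact V.mul_mem hv (V.inv_mem hv')
  · exact fun u _ => (hVo.smul u).measurableSet

/-- The sets `u V gΓ`, for `u` in a set of representatives of `U / V`, cover each point at most
`|Γ ∩ g⁻¹ U g|` times. -/
lemma card_mul_measure_le {Γ : Subgroup G} [MeasurableSpace (G ⧸ Γ)]
    [BorelSpace (G ⧸ Γ)] (μ : Measure (G ⧸ Γ)) [SMulInvariantMeasure G (G ⧸ Γ) μ]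
    {U V : Subgroup G} (hU : IsOpen (U : Set G)) (hV : IsOpen (V : Set G)) (g : G) (N : ℕ)
    (F : Set Γ) (hF : ∀ γ : Γ, g * γ * g⁻¹ ∈ U → γ ∈ F) (hFfin : F.Finite)
    (hN : F.ncard ≤ N)
    {t : Finset G} (htU : (U : Set G) = ⋃ u ∈ t, u • (V : Set G))
    (ht : ∀ u ∈ t, ∀ u' ∈ t, u⁻¹ * u' ∈ V → u = u') :
    t.card * μ ((fun x : G => ((x * g : G) : G ⧸ Γ)) '' V) ≤
      N * μ ((fun x : G => ((x * g : G) : G ⧸ Γ)) '' U) := by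
  classical
  have hopen : IsOpenMap fun x : G => ((x * g : G) : G ⧸ Γ) :=
    QuotientGroup.isOpenMap_coe.comp (isOpenMap_mul_right g)
  set A := (fun x : G => ((x * g : G) : G ⧸ Γ)) '' U with hA
  set B := (fun x : G => ((x * g : G) : G ⧸ Γ)) '' V with hB
  have hAm : MeasurableSet A := (hopen _ hU).measurableSet
  have hBo : IsOpen B := hopen _ hV
  have hBm : ∀ u : G, MeasurableSet (u • B) := fun u => (hBo.smul u).measurableSet
  have htmem : ∀ u ∈ t, ∀ v ∈ V, u * v ∈ U := fun u hu v hv => by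
    rw [← SetLike.mem_coe, htU]
    exact Set.mem_biUnion hu ⟨v, hv, rfl⟩
  have hpt : ∀ y, ∑ u ∈ t, (u • B).indicator (1 : G ⧸ Γ → ℝ≥0∞) y ≤
      A.indicator (fun _ => (N : ℝ≥0∞)) y := by
    intro y
    have hsum : ∑ u ∈ t, (u • B).indicator (1 : G ⧸ Γ → ℝ≥0∞) y =
        ((t.filter fun u => y ∈ u • B).card : ℝ≥0∞) := by
      rw [Finset.card_filter]
      push_cast
      exact Finset.sum_congr rfl fun u _ => by simp [Set.indicator_apply]
    rw [hsum]
    rcases (t.filter fun u => y ∈ u • B).eq_empty_or_nonempty with h | ⟨u₀, hu₀⟩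
    · rw [h]
      simp
    · obtain ⟨hu₀t, _, ⟨v₀, hv₀, rfl⟩, hy₀⟩ := Finset.mem_filter.1 hu₀
      have hy₀' : ((u₀ * v₀ * g : G) : G ⧸ Γ) = y := by
        rw [← hy₀, mul_assoc]
        rfl
      have hyA : y ∈ A := ⟨u₀ * v₀, htmem _ hu₀t _ hv₀, hy₀'⟩
      rw [Set.indicator_of_mem hyA]
      refine Nat.cast_le.2 (le_trans ?_ hN)
      -- Relative to one translate through `y`, any other gives an element of `Γ ∩ g⁻¹Ug`, and
      -- distinct translates give distinct elements.
      have hchoice : ∀ u ∈ t.filter fun u => y ∈ u • B, ∃ γ : Γ, ∃ v ∈ V,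
          (γ : G) = (u₀ * v₀ * g)⁻¹ * (u * v * g) := by
        intro u hu
        obtain ⟨-, _, ⟨v, hv, rfl⟩, hy⟩ := Finset.mem_filter.1 hu
        have hy' : ((u₀ * v₀ * g : G) : G ⧸ Γ) = ((u * v * g : G) : G ⧸ Γ) := by
          rw [hy₀', ← hy, mul_assoc]
          rfl
        exact ⟨⟨_, QuotientGroup.eq.1 hy'⟩, v, hv, rfl⟩
      choose! γ v hv hγ using hchoice
      rw [← Set.ncard_coe_finset]
      refine Set.ncard_le_ncard_of_injOn γ (fun u hu => hF _ ?_) (fun u hu u' hu' h => ?_) hFfin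
      · rw [hγ u hu, show g * ((u₀ * v₀ * g)⁻¹ * (u * v u * g)) * g⁻¹ =
          (u₀ * v₀)⁻¹ * (u * v u) by group]
        exact U.mul_mem (U.inv_mem (htmem _ hu₀t _ hv₀))
          (htmem _ (Finset.mem_filter.1 hu).1 _ (hv u hu))
      · have h1 := congrArg (Subtype.val : Γ → G) h
        rw [hγ u hu, hγ u' hu'] at h1
        have h2 : u * v u = u' * v u' := mul_right_cancel (mul_left_cancel h1)
        refine ht u (Finset.mem_filter.1 hu).1 u' (Finset.mem_filter.1 hu').1 ?_
        have h3 : u⁻¹ * u' = v u * (v u')⁻¹ := by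
          rw [inv_mul_eq_iff_eq_mul, ← mul_assoc, h2, mul_inv_cancel_right]
        rw [h3]
        exact V.mul_mem (hv u hu) (V.inv_mem (hv u' hu'))
  calc t.card * μ B = ∑ u ∈ t, μ (u • B) := by simp [measure_smul]
    _ = ∫⁻ y, ∑ u ∈ t, (u • B).indicator (1 : G ⧸ Γ → ℝ≥0∞) y ∂μ := by
      rw [lintegral_finsetSum _ fun u _ => measurable_one.indicator (hBm u)]
      exact Finset.sum_congr rfl fun u _ => (lintegral_indicator_one (hBm u)).symm
    _ ≤ ∫⁻ y, A.indicator (fun _ => (N : ℝ≥0∞)) y ∂μ := lintegral_mono hpt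
    _ = N * μ A := by rw [lintegral_indicator_const hAm]

variable [LocallyCompactSpace G]

/-- Uniqueness of Haar measure on sets with compact closure needs no regularity of `l`. -/
lemma measure_mul_right_eq_modularCharacter [MeasurableSpace G] [BorelSpace G] [T2Space G]
    (l : Measure G) [l.IsHaarMeasure] {K : Set G} (hK : IsCompact K) (g : G) :
    l ((fun x => x * g) ⁻¹' K) = Measure.modularCharacter g * l K := by
  have h := Measure.measure_isMulInvariant_eq_smul_of_isCompact_closure
    (Measure.map (· * g) l) l (s := K) hK.closure
  rw [← Measure.modularCharacterFun_eq_haarScalarFactor l g,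
    Measure.map_apply (measurable_mul_const g) hK.measurableSet] at h
  exact h

/-- Lower bound for the measure of the `U`-orbit of `gΓ` in terms of the order of its
stabilizer. -/
lemma modularCharacter_mul_measure_le [T2Space G] [MeasurableSpace G] [BorelSpace G]
    (l : Measure G) [l.IsHaarMeasure]
    {Γ : Subgroup G} [MeasurableSpace (G ⧸ Γ)]
    [BorelSpace (G ⧸ Γ)] (μ : Measure (G ⧸ Γ)) [SMulInvariantMeasure G (G ⧸ Γ) μ]
    {U W : Subgroup G} (hU : IsOpen (U : Set G)) (hUc : IsCompact (U : Set G))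
    (hW : IsOpen (W : Set G)) (hWc : IsCompact (W : Set G)) (hWΓ : Disjoint W Γ)
    (g : G) (N : ℕ)
    (F : Set Γ) (hF : ∀ γ : Γ, g * γ * g⁻¹ ∈ U → γ ∈ F) (hFfin : F.Finite)
    (hN : F.ncard ≤ N) :
    Measure.modularCharacter g⁻¹ * (l U * μ ((QuotientGroup.mk : G → G ⧸ Γ) '' W)) ≤
      N * l W * μ ((fun x : G => ((x * g : G) : G ⧸ Γ)) '' U) := by
  -- `V₀ = W ∩ g⁻¹Ug` and `V = U ∩ gWg⁻¹` are conjugate by `g`. Counting cosets of `V` in `U` and of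
  -- `V₀` in `W` compares both measures, and conjugation contributes the modular factor.
  let V₀ : Subgroup G := W ⊓ U.comap (MulAut.conj g).toMonoidHom
  have hconj : Continuous fun x : G => g * x * g⁻¹ := by fun_prop
  have hV₀ : IsOpen (V₀ : Set G) := hW.inter (hU.preimage hconj)
  have hV₀W : V₀ ≤ W := inf_le_left
  let V : Subgroup G := U ⊓ W.comap (MulAut.conj g⁻¹).toMonoidHom
  have hconj' : Continuous fun x : G => g⁻¹ * x * g⁻¹⁻¹ := by fun_prop
  have hV : IsOpen (V : Set G) := hU.inter (hW.preimage hconj')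
  have hVU : V ≤ U := inf_le_left
  have hVc : IsCompact (V : Set G) := hUc.of_isClosed_subset (V.isClosed_of_isOpen hV) hVU
  have hmem : ∀ x, g * x ∈ (fun y => y * g⁻¹) ⁻¹' (V : Set G) ↔ x ∈ V₀ := by
    intro x
    change g * x * g⁻¹ ∈ U ∧ g⁻¹ * (g * x * g⁻¹) * g⁻¹⁻¹ ∈ W ↔ x ∈ W ∧ g * x * g⁻¹ ∈ U
    rw [show g⁻¹ * (g * x * g⁻¹) * g⁻¹⁻¹ = x by group, and_comm]
  have hVV₀ : (fun y => y * g⁻¹) ⁻¹' (V : Set G) = g • (V₀ : Set G) := by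
    ext y
    rw [Set.mem_smul_set_iff_inv_smul_mem, smul_eq_mul, SetLike.mem_coe, ← hmem,
      mul_inv_cancel_left]
  have hlV₀ : l V₀ = Measure.modularCharacter g⁻¹ * l V := by
    rw [← measure_mul_right_eq_modularCharacter l hVc, hVV₀, measure_smul]
  have himage : (fun x : G => ((x * g : G) : G ⧸ Γ)) '' V =
      g • ((QuotientGroup.mk : G → G ⧸ Γ) '' V₀) := by
    rw [← Set.image_smul_comm (QuotientGroup.mk : G → G ⧸ Γ) g _ fun _ => rfl, ← hVV₀]
    ext y
    constructor
    · rintro ⟨x, hx, rfl⟩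
      exact ⟨x * g, by simpa using hx, rfl⟩
    · rintro ⟨x, hx, rfl⟩
      exact ⟨x * g⁻¹, hx, by simp⟩
  obtain ⟨t, htU, ht⟩ := exists_finset_coset_representatives hUc hV hVU
  obtain ⟨s, hsW, hs⟩ := exists_finset_coset_representatives hWc hV₀ hV₀W
  have h1 := card_mul_measure_le μ hU hV g N F hF hFfin hN htU ht
  rw [himage, measure_smul] at h1
  rw [measure_eq_card_mul_of_coset_representatives l hV htU ht,
    measure_image_mk_eq_card_mul μ hV₀ hV₀W hWΓ hsW hs,
    measure_eq_card_mul_of_coset_representatives l hV₀ hsW hs, hlV₀]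
  calc _ = (s.card * (Measure.modularCharacter g⁻¹ * l V)) *
        (t.card * μ ((QuotientGroup.mk : G → G ⧸ Γ) '' V₀)) := by ring
    _ ≤ _ := mul_le_mul_right h1 _
    _ = _ := by ring

/-- A lattice in a totally disconnected locally compact group whose finite subgroups have
bounded order is uniform. -/
theorem IsLatticeSubgroup.isUniformSubgroup_of_card_le [T2Space G] [TotallyDisconnectedSpace G]
    {Γ : Subgroup G} (hΓ : IsLatticeSubgroup Γ) {N : ℕ}
    (hN : ∀ F : Subgroup Γ, Finite F → Nat.card F ≤ N) : IsUniformSubgroup Γ := by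
  obtain ⟨hdisc, μ, hμ0, hμfin, hμreg, hμinv⟩ := hΓ
  let _ : MeasurableSpace (G ⧸ Γ) := borel (G ⧸ Γ)
  have : BorelSpace (G ⧸ Γ) := ⟨rfl⟩
  let _ : MeasurableSpace G := borel G
  have : BorelSpace G := ⟨rfl⟩
  obtain ⟨O, hO, hOΓ⟩ : ∃ O ∈ nhds (1 : G), ∀ x ∈ O, x ∈ Γ → x = 1 := by
    have h1 : ({1} : Set Γ) ∈ nhds (1 : Γ) := (isOpen_discrete _).mem_nhds rfl
    obtain ⟨O, hO, hO'⟩ := mem_nhds_subtype _ _ _ |>.1 h1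
    exact ⟨O, hO, fun x hx hxΓ => congrArg Subtype.val (hO' (a := ⟨x, hxΓ⟩) hx)⟩
  obtain ⟨W, hW, hWc, hWO⟩ := exists_compact_open_subgroup_subset hO
  have hWΓ : Disjoint W Γ := Subgroup.disjoint_def.2 fun hx hx' => hOΓ _ (hWO hx) hx'
  let l : Measure G := Measure.haar
  have hlW : 0 < l W := hW.measure_pos l ⟨1, W.one_mem⟩
  have hlWtop : l W ≠ ∞ := hWc.measure_lt_top.ne
  set m := μ ((QuotientGroup.mk : G → G ⧸ Γ) '' W) with hm
  have hm0 : 0 < m := measure_isOpen_pos_of_smulInvariant_of_ne_zero G hμ0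
    (QuotientGroup.isOpenMap_coe _ hW) (Set.Nonempty.image _ ⟨1, W.one_mem⟩)
  have hmtop : m ≠ ∞ := measure_ne_top μ _
  have hmain : ∀ g : G, Measure.modularCharacter g⁻¹ * (l W * m) ≤
      N * l W * μ ((fun x : G => ((x * g : G) : G ⧸ Γ)) '' W) := by
    intro g
    -- `F = Γ ∩ g⁻¹Wg` is discrete in a compact set, hence finite, and `hN` bounds its order
    -- independently of `g`.
    let F : Subgroup Γ := W.comap ((MulAut.conj g).toMonoidHom.comp Γ.subtype)
    have hFfin : (F : Set Γ).Finite := by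
      refine (Γ.finite_preimage_isCompact (hWc.image
        (by fun_prop : Continuous fun x : G => g⁻¹ * x * g))).subset fun γ hγ => ?_
      exact ⟨g * γ * g⁻¹, hγ, by group⟩
    exact modularCharacter_mul_measure_le l μ hW hWc hW hWc hWΓ g N F (fun γ hγ => hγ) hFfin
      (hN F hFfin.to_subtype)
  have hbound : ∃ B : ℝ≥0, ∀ g : G, Measure.modularCharacter g ≤ B := by
    have hpos : l W * m ≠ 0 := mul_ne_zero hlW.ne' hm0.ne'
    have htop : l W * m ≠ ∞ := ENNReal.mul_ne_top hlWtop hmtop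
    have hBtop : N * l W * μ Set.univ / (l W * m) ≠ ∞ :=
      ENNReal.div_ne_top (ENNReal.mul_ne_top (ENNReal.mul_ne_top (by simp) hlWtop)
        (measure_ne_top μ _)) hpos
    refine ⟨(N * l W * μ Set.univ / (l W * m)).toNNReal, fun g => ?_⟩
    rw [← ENNReal.coe_le_coe, ENNReal.coe_toNNReal hBtop,
      ENNReal.le_div_iff_mul_le (Or.inl hpos) (Or.inl htop)]
    have := hmain g⁻¹
    rw [inv_inv] at this
    exact this.trans (mul_le_mul_right (measure_mono (Set.subset_univ _)) _)
  -- A value above `1` would have unbounded powers; applied to `g` and `g⁻¹`, this gives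
  -- unimodularity.
  have hle : ∀ g : G, Measure.modularCharacter g ≤ 1 := by
    intro g
    obtain ⟨B, hB⟩ := hbound
    by_contra! h
    obtain ⟨n, hn⟩ := pow_unbounded_of_one_lt B h
    have := hB (g ^ n)
    rw [map_pow] at this
    exact absurd this (not_le.2 hn)
  have hone : ∀ g : G, Measure.modularCharacter g = 1 := by
    intro g
    refine le_antisymm (hle g) ?_
    calc (1 : ℝ≥0) = Measure.modularCharacter g * Measure.modularCharacter g⁻¹ := by
          rw [← map_mul, mul_inv_cancel, map_one]
      _ ≤ Measure.modularCharacter g * 1 := mul_le_mul_right (hle g⁻¹) _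
      _ = _ := mul_one _
  have hNtop : (N : ℝ≥0∞) * l W ≠ ∞ := ENNReal.mul_ne_top (by simp) hlWtop
  have hlower : ∀ g : G, l W * m / (N * l W) ≤
      μ ((fun x : G => ((x * g : G) : G ⧸ Γ)) '' W) := by
    intro g
    have := hmain g
    rw [hone, ENNReal.coe_one, one_mul] at this
    exact ENNReal.div_le_of_le_mul' this
  have horbit : ∀ g : G, MulAction.orbit W ((g : G) : G ⧸ Γ) =
      (fun x : G => ((x * g : G) : G ⧸ Γ)) '' W := by
    intro g
    ext y
    constructor
    · rintro ⟨w, rfl⟩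
      exact ⟨w, w.2, rfl⟩
    · rintro ⟨w, hw, rfl⟩
      exact ⟨⟨w, hw⟩, rfl⟩
  have horbit' : ∀ q : MulAction.orbitRel.Quotient W (G ⧸ Γ), ∃ g : G,
      q.orbit = (fun x : G => ((x * g : G) : G ⧸ Γ)) '' W := by
    intro q
    induction q using Quotient.inductionOn' with
    | h x =>
      induction x using QuotientGroup.induction_on with
      | H g => exact ⟨g, by rw [MulAction.orbitRel.Quotient.orbit_mk, horbit]⟩
  -- Disjoint orbits of mass bounded below fit only finitely often into finite total mass.
  have hfinite : Finite (MulAction.orbitRel.Quotient W (G ⧸ Γ)) := by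
    have h := Measure.finite_const_le_meas_of_disjoint_iUnion μ
      (ε := l W * m / (N * l W))
      (ENNReal.div_pos (mul_ne_zero hlW.ne' hm0.ne') hNtop)
      (As := fun q : MulAction.orbitRel.Quotient W (G ⧸ Γ) => q.orbit)
      (fun q => by
        obtain ⟨g, hg⟩ := horbit' q
        rw [hg]
        exact ((QuotientGroup.isOpenMap_coe.comp (isOpenMap_mul_right g)) _ hW).measurableSet)
      (fun q q' hqq' => Set.disjoint_left.2 fun x hx hx' => hqq' (by
        rw [MulAction.orbitRel.Quotient.mem_orbit] at hx hx'
        exact hx.symm.trans hx')) (measure_ne_top μ _)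
    refine Set.finite_univ_iff.1 (h.subset fun q _ => ?_)
    obtain ⟨g, hg⟩ := horbit' q
    change _ ≤ μ q.orbit
    rw [hg]
    exact hlower g
  have hcover : (Set.univ : Set (G ⧸ Γ)) =
      ⋃ q : MulAction.orbitRel.Quotient W (G ⧸ Γ), q.orbit := by
    refine (Set.eq_univ_of_forall fun x => Set.mem_iUnion.2 ⟨Quotient.mk'' x, ?_⟩).symm
    rw [MulAction.orbitRel.Quotient.mem_orbit]
  refine ⟨?_⟩
  rw [hcover]
  refine isCompact_iUnion fun q => ?_
  obtain ⟨g, hg⟩ := horbit' q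
  rw [hg]
  exact hWc.image (QuotientGroup.continuous_mk.comp (continuous_mul_const g))

end Lattice

theorem mainTheorem7 {G : Type*} [Group G] [TopologicalSpace G] [IsTopologicalGroup G]
    [LocallyCompactSpace G] [TotallyDisconnectedSpace G]
    (hG : IsGromovHyperbolicGroup G)
    (Γ : Subgroup G) (hΓ : IsLatticeSubgroup Γ)
    (S : Set G) (hS : IsCompactGeneratingSet S)
    (T : Set Γ) (hTfin : T.Finite) (hTgen : Subgroup.closure T = ⊤) :
    List.TFAE [IsUniformSubgroup Γ, IsUndistorted S Γ T, IsGromovHyperbolic (wordDist T)] := by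
  have : DiscreteTopology Γ := hΓ.1
  tfae_have 1 → 2 := fun h => h.isUndistorted hS hTfin hTgen
  tfae_have 2 → 3 := fun h => h.isGromovHyperbolic hG hS hTgen
  tfae_have 3 → 1 := fun h => by
    obtain ⟨N, hN⟩ := exists_card_le_of_isGromovHyperbolic hTfin hTgen h
    exact hΓ.isUniformSubgroup_of_card_le hN
  tfae_finish
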